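/- Let $\mathcal V$ be a finite non-empty vertex set with a partition into $k^\star$ non-empty sets $\mathcal C_1,\dots,\mathcal C_{k^\star}$, and let $p\in[0,1]$. Let $G$ be the random graph on $\mathcal V$ in which every $\mathcal C_l$ is a clique and every pair of vertices lying in two different sets $\mathcal C_i,\mathcal C_j$ is joined by an edge with probability $p$, independently over all such pairs. For a graph $G=(\mathcal V,\mathcal E)$ consider the semidefinite program, over $t\in\mathbb R$ and $A\in\mathbb R^{\mathcal V\times\mathcal V}$, $$\vartheta(G)=\min_{t,A}\bigl\{\,t \;:\; tI+A-J\succeq 0,\ A_{i,i}=0,\ A_{i,j}=0\text{ for all }(i,j)\notin\mathcal E\,\bigr\},\tag{P}$$ where $I$ is the identity matrix, $J$ is the all-ones matrix, and $\succeq 0$ means symmetric positive semidefinite. Let $A^\star=\sum_{l=1}^{k^\star}k^\star\mathbf 1_{\mathcal C_l}\mathbf 1_{\mathcal C_l}^T-k^\star I$. If $$p<c:=\min\Bigl\{\tfrac14\Bigl(\tfrac{\min_l 1/|\mathcal C_l|}{\sum_l 1/|\mathcal C_l|}\Bigr)^2,\ \tfrac1{100}\Bigr\},$$ then the probability that $(A^\star,k^\star)$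 is the unique optimal solution of (P) for $G$ is at least $$1-\sum_{i=1}^{k^\star}|\mathcal C_i|\sum_{j\ne i}\exp\bigl(-2|\mathcal C_j|(c-p)^2\bigr),$$ and it is strictly greater than this number when $k^\star\ge 2$. -/

import Mathlib

namespace PlantedCliqueCover

/-- Feasible points `(t, A)` of the semidefinite program defining the Lovász theta function of `G`:
`t I + A - J ⪰ 0`, and `A` vanishes on the diagonal and at all pairs that are not edges.
(`Matrix.PosSemidef` includes symmetry.) -/
def IsFeasible {V : Type*} [Fintype V] [DecidableEq V] (G : SimpleGraph V)
    (A : Matrix V V ℝ) (t : ℝ) : Prop :=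
  (t • (1 : Matrix V V ℝ) + A - Matrix.of (fun _ _ => 1)).PosSemidef ∧
    (∀ i, A i i = 0) ∧ ∀ i j, ¬ G.Adj i j → A i j = 0

/-- `(A, t)` is an optimal solution of the program: it is feasible and has least objective `t`. -/
def IsOptimal {V : Type*} [Fintype V] [DecidableEq V] (G : SimpleGraph V)
    (A : Matrix V V ℝ) (t : ℝ) : Prop :=
  IsFeasible G A t ∧ ∀ (B : Matrix V V ℝ) (s : ℝ), IsFeasible G B s → t ≤ s

/-- `(A, t)` is an optimal solution of the program, and there is no other one. -/
def IsUniqueOptimal {V : Type*} [Fintype V] [DecidableEq V] (G : SimpleGraph V)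
    (A : Matrix V V ℝ) (t : ℝ) : Prop :=
  IsOptimal G A t ∧ ∀ (B : Matrix V V ℝ) (s : ℝ), IsOptimal G B s → B = A ∧ s = t

/-- The number `k⋆` of cliques. -/
def kStar {V : Type*} [Fintype V] [DecidableEq V]
    (P : Finpartition (Finset.univ : Finset V)) : ℝ :=
  (P.parts.card : ℝ)

/-- The matrix `A⋆ = ∑_C k⋆ 1_C 1_Cᵀ - k⋆ I`, the sum being over the parts `C` of `P`. -/
noncomputable def AStar {V : Type*} [Fintype V] [DecidableEq V]
    (P : Finpartition (Finset.univ : Finset V)) : Matrix V V ℝ :=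
  ∑ C ∈ P.parts, kStar P • Matrix.vecMulVec (Set.indicator (C : Set V) (fun _ => (1 : ℝ)))
      (Set.indicator (C : Set V) (fun _ => (1 : ℝ)))
    - kStar P • (1 : Matrix V V ℝ)

/-- The disjoint union of the cliques on the parts of `P`. -/
def cliqueUnion {V : Type*} [Fintype V] [DecidableEq V]
    (P : Finpartition (Finset.univ : Finset V)) : SimpleGraph V where
  Adj u v := u ≠ v ∧ ∃ C ∈ P.parts, u ∈ C ∧ v ∈ C
  symm := ⟨fun _ _ h => ⟨h.1.symm, h.2.imp fun _ hC => ⟨hC.1, hC.2.2, hC.2.1⟩⟩⟩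
  loopless := ⟨fun _ h => h.1 rfl⟩

/-- The unordered pairs of vertices that lie in different parts of `P`. -/
def crossPairs {V : Type*} [Fintype V] [DecidableEq V]
    (P : Finpartition (Finset.univ : Finset V)) : Set (Sym2 V) :=
  {e | ¬ ∃ C ∈ P.parts, ∀ v ∈ e, v ∈ C}

/-- The planted clique cover model, as a law on graphs: every part of `P` is made a clique, and
every pair of vertices in different parts becomes an edge with probability `p`, independently. -/
noncomputable def plantedCliqueCover {V : Type*} [Fintype V] [DecidableEq V]
    (P : Finpartition (Finset.univ : Finset V)) (p : unitInterval) : MeasureTheory.Measure (SimpleGraph V) :=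
  (ProbabilityTheory.setBernoulli (crossPairs P) p).map
    (fun S => cliqueUnion P ⊔ SimpleGraph.fromEdgeSet S)

/-- The law of the planted clique cover model is a probability measure (in particular, the map
in its definition is measurable). -/
instance {V : Type*} [Fintype V] [DecidableEq V]
    (P : Finpartition (Finset.univ : Finset V)) (p : unitInterval) :
    MeasureTheory.IsProbabilityMeasure (plantedCliqueCover P p) :=
  MeasureTheory.Measure.isProbabilityMeasure_map Measurable.of_discrete.aemeasurable

theorem parts_nonempty {V : Type*} [Fintype V] [DecidableEq V] [Nonempty V]
    (P : Finpartition (Finset.univ : Finset V)) : P.parts.Nonempty :=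
  P.parts_nonempty Finset.univ_nonempty.ne_empty

/-- The threshold `c = min { (1/4) ((min_C 1/|C|) / ∑_C 1/|C|)², 1/100 }`. -/
noncomputable def threshold {V : Type*} [Fintype V] [DecidableEq V] [Nonempty V]
    (P : Finpartition (Finset.univ : Finset V)) : ℝ :=
  min (1 / 4 * (P.parts.inf' (parts_nonempty P) (fun C => 1 / (C.card : ℝ)) /
    ∑ C ∈ P.parts, 1 / (C.card : ℝ)) ^ 2) (1 / 100)

/-- The bound `∑_C |C| ∑_{D ≠ C} exp(-2 |D| (c - p)²)` on the failure probability. -/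
noncomputable def failureBound {V : Type*} [Fintype V] [DecidableEq V] [Nonempty V]
    (P : Finpartition (Finset.univ : Finset V)) (p : ℝ) : ℝ :=
  ∑ C ∈ P.parts, (C.card : ℝ) *
    ∑ D ∈ P.parts.erase C, Real.exp (-2 * (D.card : ℝ) * (threshold P - p) ^ 2)

end PlantedCliqueCover

/-!
The proof has a deterministic half and a probabilistic half.

A *transversal* is a choice of one vertex from each part such that the chosen vertices are pairwise
non-adjacent. If `T` is a transversal and `(A, t)` is feasible, then the slack matrix
`S = t I + A - J` has diagonal entries `t - 1` and off-diagonal entries `-1` on `T`, so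
`1_Tᵀ S 1_T = k⋆ (t - k⋆)`. Hence a single transversal forces `t ≥ k⋆`
(`IsTransversal.kStar_le`), and since `(A⋆, k⋆)` is feasible by the Cauchy–Schwarz inequality
(`isFeasible_AStar`), it is optimal. If moreover `t = k⋆`, then `S 1_T = 0` because `S ⪰ 0`.
Comparing two transversals that differ in one part only, at vertices `u` and `v`, shows that the
columns of `S` at `u` and `v` agree (`IsTransversal.slack_apply_eq`). When such a pair of
transversals exists for all `u, v` in a common part, `S` is constant on the blocks of the partition;
the diagonal gives the value `k⋆ - 1` inside the parts, and a non-adjacent pair gives the value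
`-1` between two parts. So `S`, and with it `A`, is determined
(`IsCrossSparse.isUniqueOptimal`). The transversals are found greedily as soon as every vertex is
adjacent to less than a `1 / k⋆` fraction of each other part
(`IsCrossSparse.exists_isTransversal_update`).

The threshold `c` satisfies `k⋆ c ≤ 1`, so it is enough that every vertex has fewer than `c |D|`
neighbours in each part `D` other than its own. For one vertex and one part this fails with
probability less than `exp (-2 |D| (c - p)²)` by Hoeffding's inequality
(`setBernoulli_card_neighbors_ge_lt`), and a union bound over vertices and parts concludes.
Hoeffding's inequality is strict here because Markov's inequality loses the contribution of the
event that the deviation does not occur, which has positive probability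
(`measure_ge_lt_of_hasSubgaussianMGF`).
-/

namespace PlantedCliqueCover

open MeasureTheory ProbabilityTheory

/-! ### A strict Hoeffding inequality -/

/-- The Chernoff bound for a sub-Gaussian variable is strict: if it were attained, the event
`{X < ε}` would contribute nothing to the exponential moment, although it has positive probability
by the non-strict bound. -/
lemma measure_ge_lt_of_hasSubgaussianMGF {Ω : Type*} [MeasurableSpace Ω] {μ : Measure Ω}
    [IsProbabilityMeasure μ] {X : Ω → ℝ} {v : NNReal} (h : HasSubgaussianMGF X v μ)
    (hX : Measurable X) {ε : ℝ} (hε : 0 < ε) (hv : 0 < v) :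
    μ.real {ω | ε ≤ X ω} < Real.exp (-ε ^ 2 / (2 * v)) := by
  have hv' : (0 : ℝ) < v := hv
  have hm : MeasurableSet {ω | ε ≤ X ω} := measurableSet_le measurable_const hX
  have hlt : μ.real {ω | ε ≤ X ω} < 1 := by
    refine (h.measure_ge_le hε.le).trans_lt (Real.exp_lt_one_iff.2 ?_)
    exact div_neg_of_neg_of_pos (by nlinarith) (by positivity)
  have hpos : 0 < μ {ω | X ω < ε} := by
    rw [pos_iff_ne_zero]
    intro h0
    have hc : {ω | X ω < ε} = {ω | ε ≤ X ω}ᶜ := by ext; simp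
    have h1 : μ.real {ω | ε ≤ X ω}ᶜ = 0 := by rw [← hc, measureReal_def, h0]; rfl
    rw [probReal_compl_eq_one_sub hm] at h1
    linarith
  -- The exponent that optimizes the Chernoff bound.
  set t : ℝ := ε / v with ht
  have ht0 : 0 < t := by positivity
  have hint := h.integrable_exp_mul t
  have hindint : Integrable ({ω | ε ≤ X ω}.indicator fun _ => Real.exp (t * ε)) μ :=
    (integrable_const _).indicator hm
  set g : Ω → ℝ := fun ω => Real.exp (t * X ω) -
    {ω | ε ≤ X ω}.indicator (fun _ => Real.exp (t * ε)) ω with hg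
  have hg0 : 0 ≤ g := by
    intro ω
    by_cases hω : ε ≤ X ω
    · simpa [hg, hω] using mul_le_mul_of_nonneg_left hω ht0.le
    · simpa [hg, hω] using (Real.exp_pos _).le
  have hgpos : 0 < ∫ ω, g ω ∂μ := by
    rw [integral_pos_iff_support_of_nonneg hg0 (hint.sub hindint)]
    refine hpos.trans_le (measure_mono fun ω hω => ?_)
    have : ¬ ε ≤ X ω := not_le.2 hω
    simp [hg, this, (Real.exp_pos _).ne']
  rw [hg, integral_sub hint hindint, integral_indicator_const _ hm, smul_eq_mul] at hgpos
  have hmgf : ∫ ω, Real.exp (t * X ω) ∂μ ≤ Real.exp (v * t ^ 2 / 2) := h.mgf_le t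
  have hlast : μ.real {ω | ε ≤ X ω} * Real.exp (t * ε) < Real.exp (v * t ^ 2 / 2) := by linarith
  rw [← lt_div_iff₀ (Real.exp_pos _), ← Real.exp_sub] at hlast
  refine hlast.trans_eq (congrArg Real.exp ?_)
  rw [ht]
  field_simp
  ring

open Classical in
/-- Strict Hoeffding inequality for the number of points of `s` in a random subset of `u`. -/
lemma setBernoulli_card_ge_lt {ι : Type*} [Finite ι] {u : Set ι} (p : unitInterval)
    {s : Finset ι} (hs : (s : Set ι) ⊆ u) (hs0 : s.Nonempty) {c : ℝ} (hc : (p : ℝ) < c) :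
    (setBernoulli u p).real {S | c * s.card ≤ (s.filter (· ∈ S)).card} <
      Real.exp (-2 * s.card * (c - p) ^ 2) := by
  set ν : ι → Measure Prop := fun i =>
    unitInterval.toNNReal p • Measure.dirac (i ∈ u) +
      unitInterval.toNNReal (unitInterval.symm p) • Measure.dirac False with hν
  set μ := Measure.infinitePi ν
  set X : ι → (ι → Prop) → ℝ := fun i ω => (if ω i then (1 : ℝ) else 0) - p with hX
  have hprob : ∀ i, IsProbabilityMeasure (ν i) := fun i => by
    constructor
    simp [hν]
  have hmeas : ∀ i, Measurable (X i) := fun i =>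
    (Measurable.of_discrete (f := fun q : Prop => (if q then (1 : ℝ) else 0) - p)).comp
      (measurable_pi_apply i)
  have hindep : iIndepFun X μ :=
    iIndepFun_infinitePi (P := ν) (X := fun _ (q : Prop) => (if q then (1 : ℝ) else 0) - p)
      fun _ => Measurable.of_discrete
  have hmean : ∀ i ∈ s, ∫ ω, (if ω i then (1 : ℝ) else 0) ∂μ = p := fun i hi => by
    have h1 : ∫ ω, (if ω i then (1 : ℝ) else 0) ∂μ = ∫ q, (if q then (1 : ℝ) else 0) ∂(ν i) := by
      rw [← Measure.infinitePi_map_eval ν i, integral_map (measurable_pi_apply i).aemeasurable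
        Measurable.of_discrete.aestronglyMeasurable]
    rw [h1, hν, integral_add_measure (Integrable.of_finite) (Integrable.of_finite)]
    have : i ∈ u := hs hi
    simp [this, NNReal.smul_def]
  -- Hoeffding's lemma on `[0, 1]` gives the variance proxy `((1 - 0) / 2) ^ 2`.
  have hsub : ∀ i ∈ s, HasSubgaussianMGF (X i) (1 / 4) μ := fun i hi => by
    have := hasSubgaussianMGF_of_mem_Icc (μ := μ) (a := 0) (b := 1)
      (X := fun ω : ι → Prop => if ω i then (1 : ℝ) else 0)
      (((Measurable.of_discrete (f := fun q : Prop => (if q then (1 : ℝ) else 0))).comp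
        (measurable_pi_apply i)).aemeasurable)
      (.of_forall fun ω => by by_cases h : ω i <;> simp [h])
    rw [hmean i hi] at this
    convert this using 1
    ext; norm_num
  have hsum := HasSubgaussianMGF.sum_of_iIndepFun hindep hsub
  have hn : 0 < s.card := hs0.card_pos
  have hn' : (0 : ℝ) < s.card := by exact_mod_cast hn
  have key := measure_ge_lt_of_hasSubgaussianMGF hsum (Finset.measurable_sum _ fun i _ => hmeas i)
    (ε := s.card * (c - p)) (mul_pos hn' (by linarith)) (by
      rw [Finset.sum_const, nsmul_eq_mul]
      exact mul_pos (by exact_mod_cast hn) (by norm_num))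
  rw [measureReal_def, setBernoulli_apply', ← measureReal_def]
  convert key using 2
  · ext ω
    simp only [Set.mem_preimage, Set.mem_ofPred_eq, hX, Finset.sum_sub_distrib, Finset.sum_boole,
      Finset.sum_const, nsmul_eq_mul]
    constructor <;> intro h <;> linarith
  · push_cast
    simp only [Finset.sum_const, nsmul_eq_mul]
    field_simp
    ring

/-! ### Transversals and the slack matrix -/

variable {V : Type*} [Fintype V] [DecidableEq V]

/-- `σ` picks from every part of `P` one vertex, and the vertices picked are pairwise non-adjacent
in `G`. The values of `σ` outside `P.parts` play no role. -/
structure IsTransversal (P : Finpartition (Finset.univ : Finset V)) (G : SimpleGraph V)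
    (σ : Finset V → V) : Prop where
  mem : ∀ C ∈ P.parts, σ C ∈ C
  not_adj : ∀ C ∈ P.parts, ∀ D ∈ P.parts, ¬ G.Adj (σ C) (σ D)

/-- The slack matrix `t I + A - J` of the semidefinite constraint. -/
def slack (A : Matrix V V ℝ) (t : ℝ) : Matrix V V ℝ :=
  t • (1 : Matrix V V ℝ) + A - Matrix.of (fun _ _ => 1)

omit [Fintype V] in
lemma slack_apply (A : Matrix V V ℝ) (t : ℝ) (i j : V) :
    slack A t i j = (if i = j then t else 0) + A i j - 1 := by
  simp [slack, Matrix.one_apply]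

variable {P : Finpartition (Finset.univ : Finset V)} {G : SimpleGraph V}
  {A : Matrix V V ℝ} {t : ℝ} {σ τ : Finset V → V}

lemma IsFeasible.posSemidef_slack (h : IsFeasible G A t) : (slack A t).PosSemidef := h.1

/-- The indicator vector of the vertices that `σ` picks from the parts of `P`. -/
def transversalVec (P : Finpartition (Finset.univ : Finset V)) (σ : Finset V → V) : V → ℝ :=
  ∑ C ∈ P.parts, Pi.single (σ C) 1

lemma mulVec_transversalVec (M : Matrix V V ℝ) (w : V) :
    (M.mulVec (transversalVec P σ)) w = ∑ C ∈ P.parts, M w (σ C) := by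
  simp [transversalVec, Matrix.mulVec_sum, Finset.sum_apply]

lemma transversalVec_dotProduct (y : V → ℝ) :
    transversalVec P σ ⬝ᵥ y = ∑ C ∈ P.parts, y (σ C) := by
  simp [transversalVec, sum_dotProduct]

lemma IsTransversal.dotProduct_slack (hσ : IsTransversal P G σ) (h : IsFeasible G A t) :
    transversalVec P σ ⬝ᵥ ((slack A t).mulVec (transversalVec P σ)) = kStar P * (t - kStar P) := by
  simp only [transversalVec_dotProduct, mulVec_transversalVec]
  have key : ∀ C ∈ P.parts, ∑ D ∈ P.parts,
      slack A t (σ C) (σ D) = t - kStar P := by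
    intro C hC
    have : ∀ D ∈ P.parts, slack A t (σ C) (σ D) =
        (if C = D then t else 0) - 1 := by
      intro D hD
      have hiff : σ C = σ D ↔ C = D :=
        ⟨fun he => P.eq_of_mem_parts hC hD (hσ.mem C hC) (he ▸ hσ.mem D hD), fun he => he ▸ rfl⟩
      simp [slack_apply, h.2.2 _ _ (hσ.not_adj C hC D hD), hiff]
    rw [Finset.sum_congr rfl this, Finset.sum_sub_distrib]
    simp [hC, kStar]
  rw [Finset.sum_congr rfl key, Finset.sum_const, nsmul_eq_mul, kStar]

lemma IsTransversal.kStar_le [Nonempty V] (hσ : IsTransversal P G σ) (h : IsFeasible G A t) :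
    kStar P ≤ t := by
  have h0 := h.posSemidef_slack.dotProduct_mulVec_nonneg (transversalVec P σ)
  rw [star_trivial, hσ.dotProduct_slack h] at h0
  have hk : 0 < kStar P := by
    have := (parts_nonempty P).card_pos
    rw [kStar]; exact_mod_cast this
  nlinarith [nonneg_of_mul_nonneg_right h0 hk]

lemma IsTransversal.slack_mulVec (hσ : IsTransversal P G σ) (h : IsFeasible G A (kStar P)) :
    (slack A (kStar P)).mulVec (transversalVec P σ) = 0 := by
  rw [← h.posSemidef_slack.dotProduct_mulVec_zero_iff, star_trivial, hσ.dotProduct_slack h, sub_self,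
    mul_zero]

/-- If two transversals differ only in the part `C`, subtracting their indicator vectors shows that
the columns of an optimal slack matrix agree at the two vertices picked from `C`. -/
lemma IsTransversal.slack_apply_eq (hσ : IsTransversal P G σ) (hτ : IsTransversal P G τ)
    (h : IsFeasible G A (kStar P)) {C : Finset V} (hC : C ∈ P.parts)
    (hστ : ∀ D ∈ P.parts, D ≠ C → σ D = τ D) (w : V) :
    slack A (kStar P) w (σ C) = slack A (kStar P) w (τ C) := by
  have h1 := congrFun (hσ.slack_mulVec h) w
  have h2 := congrFun (hτ.slack_mulVec h) w
  rw [mulVec_transversalVec, ← Finset.add_sum_erase _ _ hC] at h1 h2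
  have h3 : ∀ D ∈ P.parts.erase C,
      slack A (kStar P) w (σ D) = slack A (kStar P) w (τ D) := fun D hD => by
    rw [hστ D (Finset.mem_of_mem_erase hD) (Finset.ne_of_mem_erase hD)]
  rw [Finset.sum_congr rfl h3] at h1
  exact add_right_cancel (h1.trans h2.symm)

/-! ### Greedy construction of transversals -/

open Classical in
/-- Every vertex is adjacent to less than a `1 / k⋆` fraction of each part other than its own. -/
def IsCrossSparse (P : Finpartition (Finset.univ : Finset V)) (G : SimpleGraph V) : Prop :=
  ∀ C ∈ P.parts, ∀ v ∈ C, ∀ D ∈ P.parts, D ≠ C →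
    P.parts.card * (D.filter (G.Adj v)).card < D.card

open Classical in
/-- The neighbourhoods of at most `k⋆` vertices outside a part `D` do not cover `D`. -/
lemma IsCrossSparse.exists_not_adj (hG : IsCrossSparse P G) {D : Finset V} (hD : D ∈ P.parts)
    {W : Finset V} (hW : W.card ≤ P.parts.card) (hWD : Disjoint W D) :
    ∃ x ∈ D, ∀ w ∈ W, ¬ G.Adj w x := by
  by_contra! hcon
  have hsub : D ⊆ W.biUnion fun w => D.filter (G.Adj w) := fun x hx => by
    obtain ⟨w, hw, hwx⟩ := hcon x hx
    exact Finset.mem_biUnion.2 ⟨w, hw, Finset.mem_filter.2 ⟨hx, hwx⟩⟩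
  have hWne : W.Nonempty := by
    obtain ⟨x, hx⟩ := P.nonempty_of_mem_parts hD
    obtain ⟨w, hw, -⟩ := hcon x hx
    exact ⟨w, hw⟩
  have h1 : ∑ w ∈ W, P.parts.card * (D.filter (G.Adj w)).card < ∑ _w ∈ W, D.card := by
    refine Finset.sum_lt_sum_of_nonempty hWne fun w hw => ?_
    refine hG (P.part w) (P.part_mem.2 (Finset.mem_univ w)) w
      (P.mem_part (Finset.mem_univ w)) D hD fun he => ?_
    exact Finset.disjoint_left.1 hWD hw (he ▸ P.mem_part (Finset.mem_univ w))
  have h2 := (Finset.card_le_card hsub).trans Finset.card_biUnion_le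
  have h3 := Nat.mul_le_mul_right D.card hW
  rw [← Finset.mul_sum, Finset.sum_const, smul_eq_mul] at h1
  have h4 := Nat.mul_le_mul_left P.parts.card h2
  omega

/-- Two vertices `u, v` of a common part extend to transversals that agree in all other parts. -/
lemma IsCrossSparse.exists_isTransversal_update (hG : IsCrossSparse P G) {C : Finset V}
    (hC : C ∈ P.parts) {u v : V} (hu : u ∈ C) (hv : v ∈ C) :
    ∃ σ, IsTransversal P G (Function.update σ C u) ∧
      IsTransversal P G (Function.update σ C v) := by
  -- Pick vertices from the other parts one at a time, avoiding the neighbours of `u`, of `v` and of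
  -- the vertices already picked: before each step these are at most `2 + (k⋆ - 2)` vertices.
  have key : ∀ s : Finset (Finset V), s ⊆ P.parts.erase C → ∃ σ : Finset V → V,
      (∀ D ∈ s, σ D ∈ D) ∧ (∀ D ∈ s, ∀ E ∈ s, ¬ G.Adj (σ D) (σ E)) ∧
      ∀ D ∈ s, ¬ G.Adj u (σ D) ∧ ¬ G.Adj v (σ D) := by
    intro s
    induction s using Finset.induction_on with
    | empty => exact fun _ => ⟨fun _ => u, by simp⟩
    | insert D s hDs ih =>
      intro hs
      obtain ⟨σ, h1, h2, h3⟩ := ih ((Finset.subset_insert D s).trans hs)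
      have hD := hs (Finset.mem_insert_self D s)
      have hDP := Finset.mem_of_mem_erase hD
      have hDC := Finset.ne_of_mem_erase hD
      obtain ⟨x, hxD, hx⟩ := hG.exists_not_adj hDP (W := insert u (insert v (s.image σ)))
        (by
          have e1 := Finset.card_insert_le u (insert v (s.image σ))
          have e2 := Finset.card_insert_le v (s.image σ)
          have e3 := Finset.card_image_le (s := s) (f := σ)
          have e4 := Finset.card_le_card hs
          rw [Finset.card_insert_of_notMem hDs, Finset.card_erase_of_mem hC] at e4
          have e5 := Finset.card_pos.2 ⟨C, hC⟩
          omega)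
        (by
          rw [Finset.disjoint_left]
          intro w hw hwD
          simp only [Finset.mem_insert, Finset.mem_image] at hw
          rcases hw with rfl | rfl | ⟨E, hE, rfl⟩
          · exact hDC (P.eq_of_mem_parts hDP hC hwD hu)
          · exact hDC (P.eq_of_mem_parts hDP hC hwD hv)
          · have hEP := Finset.mem_of_mem_erase (hs (Finset.mem_insert_of_mem hE))
            exact hDs (P.eq_of_mem_parts hEP hDP (h1 E hE) hwD ▸ hE))
      have hne : ∀ E ∈ s, E ≠ D := fun E hE he => hDs (he ▸ hE)
      have hxu := hx u (by simp)
      have hxv := hx v (by simp)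
      have hxs : ∀ E ∈ s, ¬ G.Adj (σ E) x := fun E hE => hx _ (by
        simp only [Finset.mem_insert, Finset.mem_image]; exact .inr (.inr ⟨E, hE, rfl⟩))
      refine ⟨Function.update σ D x, ?_, ?_, ?_⟩
      · intro E hE
        rcases Finset.mem_insert.1 hE with rfl | hE
        · simpa using hxD
        · simpa [hne E hE] using h1 E hE
      · intro E hE F hF
        rcases Finset.mem_insert.1 hE with hE | hE <;> rcases Finset.mem_insert.1 hF with hF | hF
        · simp [hE, hF]
        · simpa [hE, hne F hF, G.adj_comm] using hxs F hF
        · simpa [hF, hne E hE] using hxs E hE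
        · simpa [hne E hE, hne F hF] using h2 E hE F hF
      · intro E hE
        rcases Finset.mem_insert.1 hE with rfl | hE
        · simpa using ⟨hxu, hxv⟩
        · simpa [hne E hE] using h3 E hE
  obtain ⟨σ, h1, h2, h3⟩ := key _ subset_rfl
  have aux : ∀ w ∈ C, (∀ D ∈ P.parts.erase C, ¬ G.Adj w (σ D)) →
      IsTransversal P G (Function.update σ C w) := by
    intro w hw hadj
    constructor
    · intro D hD
      by_cases hDC : D = C
      · subst hDC; simpa using hw
      · simpa [hDC] using h1 D (Finset.mem_erase.2 ⟨hDC, hD⟩)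
    · intro D hD E hE
      by_cases hDC : D = C <;> by_cases hEC : E = C
      · subst hDC; subst hEC; simp
      · subst hDC; simpa [hEC] using hadj E (Finset.mem_erase.2 ⟨hEC, hE⟩)
      · subst hEC; simpa [hDC, G.adj_comm] using hadj D (Finset.mem_erase.2 ⟨hDC, hD⟩)
      · simpa [hDC, hEC] using
          h2 D (Finset.mem_erase.2 ⟨hDC, hD⟩) E (Finset.mem_erase.2 ⟨hEC, hE⟩)
  exact ⟨σ, aux u hu fun D hD => (h3 D hD).1, aux v hv fun D hD => (h3 D hD).2⟩

/-! ### Feasibility of the planted solution -/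

lemma sum_indicator_mul_indicator_apply (i j : V) :
    ∑ C ∈ P.parts, Set.indicator (C : Set V) (fun _ => (1 : ℝ)) i *
      Set.indicator (C : Set V) (fun _ => (1 : ℝ)) j = if P.part i = P.part j then 1 else 0 := by
  have hi := P.part_mem.2 (Finset.mem_univ i)
  have hii := P.mem_part (Finset.mem_univ i)
  have hjj := P.mem_part (Finset.mem_univ j)
  rw [Finset.sum_eq_single_of_mem (P.part i) hi]
  · rw [Set.indicator_of_mem (by simp), one_mul]
    split_ifs with h
    · exact Set.indicator_of_mem (by simp [h]) _
    · refine Set.indicator_of_notMem (fun hj => h ?_) _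
      exact P.eq_of_mem_parts hi (P.part_mem.2 (Finset.mem_univ j)) hj hjj
  · intro C hC hne
    rw [Set.indicator_of_notMem, zero_mul]
    exact fun h => hne (P.eq_of_mem_parts hC hi h hii)

lemma slack_AStar_apply (i j : V) :
    slack (AStar P) (kStar P) i j =
      (if P.part i = P.part j then kStar P else 0) - 1 := by
  have := congrArg (kStar P * ·) (sum_indicator_mul_indicator_apply (P := P) i j)
  simp only [Finset.mul_sum, mul_ite, mul_one, mul_zero] at this
  rw [← this]
  rw [slack_apply]
  simp [AStar, Matrix.sum_apply, Matrix.vecMulVec_apply, Matrix.one_apply]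

/-- The quadratic form of the slack matrix of `(A⋆, k⋆)` is `k⋆ ∑_C s_C² - (∑_C s_C)²`, where `s_C`
is the sum of the coordinates over `C`; it is nonnegative by the Cauchy–Schwarz inequality. -/
lemma posSemidef_slack_AStar : (slack (AStar P) (kStar P)).PosSemidef := by
  refine .of_dotProduct_mulVec_nonneg ?_ fun x => ?_
  · ext i j
    rw [Matrix.conjTranspose_apply, slack_AStar_apply, slack_AStar_apply, star_trivial]
    simp only [eq_comm]
  · have hsum : ∀ f : V → ℝ, ∑ C ∈ P.parts, ∑ i ∈ C, f i = ∑ i, f i := fun f => by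
      exact (Finset.sum_biUnion P.supIndep.pairwiseDisjoint).symm.trans
        (Finset.sum_congr P.biUnion_parts fun _ _ => rfl)
    have hpart : ∀ C ∈ P.parts, ∀ i ∈ C, P.part i = C := fun C hC i hi =>
      P.eq_of_mem_parts (P.part_mem.2 (Finset.mem_univ i)) hC (P.mem_part (Finset.mem_univ i)) hi
    have hquad : star x ⬝ᵥ ((slack (AStar P) (kStar P)).mulVec x) =
        kStar P * ∑ C ∈ P.parts, (∑ i ∈ C, x i) ^ 2 - (∑ C ∈ P.parts, ∑ i ∈ C, x i) ^ 2 := by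
      simp only [dotProduct, Matrix.mulVec, slack_AStar_apply, star_trivial]
      have h1 : ∀ i, ∑ j, ((if P.part i = P.part j then kStar P else 0) - 1) * x j =
          kStar P * ∑ j ∈ P.part i, x j - ∑ j, x j := fun i => by
        simp only [sub_mul, Finset.sum_sub_distrib, one_mul, ite_mul, zero_mul, ← Finset.sum_filter,
          ← Finset.mul_sum]
        congr 3
        ext j
        simp only [Finset.mem_filter, Finset.mem_univ, true_and]
        exact ⟨fun h => h ▸ P.mem_part (Finset.mem_univ j),
          fun h => (hpart _ (P.part_mem.2 (Finset.mem_univ i)) j h).symm⟩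
      have h2 : ∑ i, x i * ∑ j ∈ P.part i, x j = ∑ C ∈ P.parts, (∑ i ∈ C, x i) ^ 2 := by
        rw [← hsum]
        refine Finset.sum_congr rfl fun C hC => ?_
        rw [sq, Finset.sum_mul]
        exact Finset.sum_congr rfl fun i hi => by rw [hpart C hC i hi]
      simp only [h1, mul_sub, Finset.sum_sub_distrib, mul_left_comm _ (kStar P)]
      rw [← Finset.mul_sum, ← Finset.sum_mul, h2, hsum, sq (∑ i, x i)]
    rw [hquad, sub_nonneg, kStar]
    exact sq_sum_le_card_mul_sum_sq

lemma isFeasible_AStar (hG : cliqueUnion P ≤ G) : IsFeasible G (AStar P) (kStar P) := by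
  have hA : ∀ i j, AStar P i j = (if P.part i = P.part j then kStar P else 0) -
      if i = j then kStar P else 0 := fun i j => by
    have := slack_AStar_apply (P := P) i j
    rw [slack_apply] at this
    linarith
  refine ⟨posSemidef_slack_AStar, fun i => by simp [hA], fun i j hij => ?_⟩
  rw [hA]
  by_cases h : i = j
  · simp [h]
  · have : P.part i ≠ P.part j := fun he => hij (hG ⟨h, P.part i,
      P.part_mem.2 (Finset.mem_univ i), P.mem_part (Finset.mem_univ i),
      he ▸ P.mem_part (Finset.mem_univ j)⟩)
    simp [h, this]

/-! ### Unique optimality for sparsely connected cliques -/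

theorem IsCrossSparse.isUniqueOptimal [Nonempty V] (hG : IsCrossSparse P G)
    (hPG : cliqueUnion P ≤ G) : IsUniqueOptimal G (AStar P) (kStar P) := by
  obtain ⟨C₀, hC₀⟩ := parts_nonempty P
  obtain ⟨u₀, hu₀⟩ := P.nonempty_of_mem_parts hC₀
  obtain ⟨σ₀, hσ₀, -⟩ := hG.exists_isTransversal_update hC₀ hu₀ hu₀
  have hfeas := isFeasible_AStar hPG
  refine ⟨⟨hfeas, fun B s hB => hσ₀.kStar_le hB⟩, fun B s hB => ?_⟩
  obtain rfl : s = kStar P := le_antisymm (hB.2 _ _ hfeas) (hσ₀.kStar_le hB.1)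
  refine ⟨?_, rfl⟩
  have hB' := hB.1
  have hconst : ∀ w u v, P.part u = P.part v →
      slack B (kStar P) w u = slack B (kStar P) w v := by
    intro w u v huv
    have hC := P.part_mem.2 (Finset.mem_univ u)
    obtain ⟨σ, h1, h2⟩ := hG.exists_isTransversal_update hC (P.mem_part (Finset.mem_univ u))
      (huv ▸ P.mem_part (Finset.mem_univ v))
    have := h1.slack_apply_eq h2 hB' hC (fun D _ hDC => by simp [hDC]) w
    simpa using this
  have hslack : slack B (kStar P) = slack (AStar P) (kStar P) := by
    ext i j
    rw [slack_AStar_apply]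
    split_ifs with h
    -- Inside a part, the common value of the block is read off the diagonal.
    · rw [hconst i j i h.symm]
      simp [slack_apply, hB'.2.1]
    -- Between two parts, it is read off a non-adjacent pair.
    · have hj := P.part_mem.2 (Finset.mem_univ j)
      obtain ⟨x, hx, hix⟩ := hG.exists_not_adj hj (W := {i})
        (by simpa using Finset.card_pos.2 ⟨_, hj⟩)
        (by
          rw [Finset.disjoint_singleton_left]
          exact fun hi => h (P.eq_of_mem_parts (P.part_mem.2 (Finset.mem_univ i)) hj
            (P.mem_part (Finset.mem_univ i)) hi))
      have hxj : P.part j = P.part x := P.eq_of_mem_parts hj (P.part_mem.2 (Finset.mem_univ x)) hx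
        (P.mem_part (Finset.mem_univ x))
      have hne : i ≠ x := fun he => h (by rw [he, hxj])
      rw [hconst i j x hxj]
      simp [slack_apply, hB'.2.2 i x (hix i (by simp)), hne]
  simpa [slack] using hslack

/-! ### The random graph -/

/-- The harmonic ratio in the threshold is a minimum over a sum of `k⋆` terms, so it is at most
`1 / k⋆`, and the threshold is at most `1 / (4 k⋆ ^ 2)`. -/
lemma card_mul_threshold_le_one [Nonempty V] : (P.parts.card : ℝ) * threshold P ≤ 1 := by
  have hk : 0 < P.parts.card := (parts_nonempty P).card_pos
  have hk1 : (1 : ℝ) ≤ P.parts.card := by exact_mod_cast hk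
  have hpos : ∀ C ∈ P.parts, 0 < 1 / (C.card : ℝ) := fun C hC => by
    have := (P.nonempty_of_mem_parts hC).card_pos
    positivity
  set m := P.parts.inf' (parts_nonempty P) (fun C => 1 / (C.card : ℝ))
  set T := ∑ C ∈ P.parts, 1 / (C.card : ℝ)
  have hm0 : 0 ≤ m := Finset.le_inf' _ _ fun C hC => (hpos C hC).le
  have hS0 : 0 < T := Finset.sum_pos hpos (parts_nonempty P)
  have hmS : P.parts.card * m ≤ T := by
    simpa only [nsmul_eq_mul] using Finset.card_nsmul_le_sum P.parts (fun C => 1 / (C.card : ℝ)) m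
      fun C hC => Finset.inf'_le _ hC
  have hr : (P.parts.card : ℝ) * (m / T) ≤ 1 := by
    rw [← mul_div_assoc]; exact (div_le_one hS0).2 hmS
  have hr0 : 0 ≤ m / T := div_nonneg hm0 hS0.le
  have hc : threshold P ≤ 1 / 4 * (m / T) ^ 2 := min_le_left _ _
  clear_value m T
  generalize m / T = r at hr hr0 hc
  have hr1 : r ≤ 1 := (le_mul_of_one_le_left hr0 hk1).trans hr
  calc (P.parts.card : ℝ) * threshold P ≤ P.parts.card * (1 / 4 * r ^ 2) := by gcongr
    _ = 1 / 4 * (P.parts.card * r) * r := by ring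
    _ ≤ 1 := by nlinarith

lemma adj_sup_fromEdgeSet_iff {S : Set (Sym2 V)} {C D : Finset V} (hC : C ∈ P.parts)
    (hD : D ∈ P.parts) (hDC : D ≠ C) {v w : V} (hv : v ∈ C) (hw : w ∈ D) :
    (cliqueUnion P ⊔ SimpleGraph.fromEdgeSet S).Adj v w ↔ s(v, w) ∈ S := by
  have h1 : ¬ (cliqueUnion P).Adj v w := fun ⟨_, E, hE, hvE, hwE⟩ =>
    hDC ((P.eq_of_mem_parts hD hE hw hwE).trans (P.eq_of_mem_parts hE hC hvE hv))
  have h2 : v ≠ w := fun h => hDC (P.eq_of_mem_parts hD hC hw (h ▸ hv))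
  simp [h1, h2]

open Classical in
lemma setBernoulli_card_neighbors_ge_lt (p : unitInterval) {c : ℝ} (hc : (p : ℝ) < c)
    {C D : Finset V} (hC : C ∈ P.parts) (hD : D ∈ P.parts) (hDC : D ≠ C) {v : V} (hv : v ∈ C) :
    (setBernoulli (crossPairs P) p).real
      {S | c * D.card ≤ (D.filter fun w => s(v, w) ∈ S).card} <
        Real.exp (-2 * D.card * (c - p) ^ 2) := by
  have hinj : Function.Injective fun w : V => s(v, w) := fun _ _ h => Sym2.congr_right.1 h
  have key := setBernoulli_card_ge_lt (u := crossPairs P) p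
    (s := D.image fun w => s(v, w)) ?_ ((P.nonempty_of_mem_parts hD).image _) hc
  · simpa only [Finset.filter_image, Finset.card_image_of_injective _ hinj] using key
  · intro e he
    obtain ⟨w, hw, rfl⟩ := Finset.mem_image.1 (Finset.mem_coe.1 he)
    rintro ⟨E, hE, hall⟩
    exact hDC ((P.eq_of_mem_parts hD hE hw (hall w (by simp))).trans
      (P.eq_of_mem_parts hE hC (hall v (by simp)) hv))

open Classical in
lemma isUniqueOptimal_sup_fromEdgeSet [Nonempty V] {S : Set (Sym2 V)}
    (hS : ∀ C ∈ P.parts, ∀ v ∈ C, ∀ D ∈ P.parts.erase C,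
      ((D.filter fun w => s(v, w) ∈ S).card : ℝ) < threshold P * D.card) :
    IsUniqueOptimal (cliqueUnion P ⊔ SimpleGraph.fromEdgeSet S) (AStar P) (kStar P) := by
  refine IsCrossSparse.isUniqueOptimal (fun C hC v hv D hD hDC => ?_) le_sup_left
  have h := hS C hC v hv D (Finset.mem_erase.2 ⟨hDC, hD⟩)
  have hk : (0 : ℝ) < P.parts.card := by exact_mod_cast Finset.card_pos.2 ⟨C, hC⟩
  have hkc := card_mul_threshold_le_one (P := P)
  have : (P.parts.card : ℝ) * (D.filter fun w => s(v, w) ∈ S).card < D.card := by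
    calc _ < (P.parts.card : ℝ) * (threshold P * D.card) := mul_lt_mul_of_pos_left h hk
      _ = P.parts.card * threshold P * D.card := by ring
      _ ≤ 1 * D.card := by gcongr
      _ = _ := one_mul _
  calc P.parts.card * _ = P.parts.card * (D.filter fun w => s(v, w) ∈ S).card := by
        congr 2
        ext w
        simp only [Finset.mem_filter]
        exact and_congr_right fun hw => adj_sup_fromEdgeSet_iff hC hD hDC hv hw
    _ < D.card := by exact_mod_cast this

open Classical in
/-- Union bound: recovery fails only if some vertex has at least a `c` fraction of some other part
as its neighbours. -/
lemma one_sub_sum_bad_le [Nonempty V] (p : unitInterval) :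
    1 - ∑ C ∈ P.parts, ∑ v ∈ C, ∑ D ∈ P.parts.erase C, (setBernoulli (crossPairs P) p).real
        {S | threshold P * D.card ≤ (D.filter fun w => s(v, w) ∈ S).card} ≤
      (plantedCliqueCover P p).real {G | IsUniqueOptimal G (AStar P) (kStar P)} := by
  set μ := setBernoulli (crossPairs P) p
  set f : Set (Sym2 V) → SimpleGraph V := fun S => cliqueUnion P ⊔ SimpleGraph.fromEdgeSet S
  set good : Set (Set (Sym2 V)) := f ⁻¹' {G | IsUniqueOptimal G (AStar P) (kStar P)}
  set bad : V → Finset V → Set (Set (Sym2 V)) := fun v D =>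
    {S | threshold P * D.card ≤ (D.filter fun w => s(v, w) ∈ S).card} with hbad
  have hmap : μ.real good ≤
      (plantedCliqueCover P p).real {G | IsUniqueOptimal G (AStar P) (kStar P)} :=
    ENNReal.toReal_mono (measure_ne_top _ _)
      (Measure.le_map_apply Measurable.of_discrete.aemeasurable _)
  have hsub : goodᶜ ⊆ ⋃ C ∈ P.parts, ⋃ v ∈ C, ⋃ D ∈ P.parts.erase C, bad v D := by
    intro S hS
    by_contra hcon
    simp only [Set.mem_iUnion, not_exists, hbad, Set.mem_ofPred_eq, not_le] at hcon
    exact hS (isUniqueOptimal_sup_fromEdgeSet hcon)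
  have hunion : μ.real goodᶜ ≤
      ∑ C ∈ P.parts, ∑ v ∈ C, ∑ D ∈ P.parts.erase C, μ.real (bad v D) := by
    refine (measureReal_mono hsub (measure_ne_top _ _)).trans
      ((measureReal_biUnion_finset_le _ _).trans ?_)
    refine Finset.sum_le_sum fun C _ => (measureReal_biUnion_finset_le _ _).trans ?_
    exact Finset.sum_le_sum fun v _ => measureReal_biUnion_finset_le _ _
  rw [probReal_compl_eq_one_sub .of_discrete] at hunion
  linarith

end PlantedCliqueCover

theorem mainTheorem1 {V : Type*} [Fintype V] [DecidableEq V] [Nonempty V]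
    (P : Finpartition (Finset.univ : Finset V)) (p : unitInterval)
    (hp : (p : ℝ) < PlantedCliqueCover.threshold P) :
    1 - PlantedCliqueCover.failureBound P p ≤
        (PlantedCliqueCover.plantedCliqueCover P p).real
          {G | PlantedCliqueCover.IsUniqueOptimal G
            (PlantedCliqueCover.AStar P) (PlantedCliqueCover.kStar P)} ∧
      (2 ≤ P.parts.card →
        1 - PlantedCliqueCover.failureBound P p <
          (PlantedCliqueCover.plantedCliqueCover P p).real
            {G | PlantedCliqueCover.IsUniqueOptimal G
              (PlantedCliqueCover.AStar P) (PlantedCliqueCover.kStar P)}) := by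
  classical
  open PlantedCliqueCover ProbabilityTheory in
  have hlt : ∀ C ∈ P.parts, ∀ v ∈ C, ∀ D ∈ P.parts.erase C,
      (setBernoulli (crossPairs P) p).real
        {S | threshold P * D.card ≤ (D.filter fun w => s(v, w) ∈ S).card} <
      Real.exp (-2 * (D.card : ℝ) * (threshold P - p) ^ 2) := fun C hC v hv D hD =>
    setBernoulli_card_neighbors_ge_lt p hp hC (Finset.mem_of_mem_erase hD)
      (Finset.ne_of_mem_erase hD) hv
  have hbound : PlantedCliqueCover.failureBound P p = ∑ C ∈ P.parts, ∑ _v ∈ C,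
      ∑ D ∈ P.parts.erase C,
        Real.exp (-2 * (D.card : ℝ) * (PlantedCliqueCover.threshold P - p) ^ 2) := by
    simp [PlantedCliqueCover.failureBound]
  have hmain := PlantedCliqueCover.one_sub_sum_bad_le (P := P) p
  refine ⟨le_trans (sub_le_sub_left ?_ 1) hmain, fun hk =>
    lt_of_lt_of_le (sub_lt_sub_left ?_ 1) hmain⟩
  · rw [hbound]
    exact Finset.sum_le_sum fun C hC => Finset.sum_le_sum fun v hv =>
      Finset.sum_le_sum fun D hD => (hlt C hC v hv D hD).le
  · rw [hbound]
    refine Finset.sum_lt_sum_of_nonempty (PlantedCliqueCover.parts_nonempty P) fun C hC =>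
      Finset.sum_lt_sum_of_nonempty (P.nonempty_of_mem_parts hC) fun v hv =>
        Finset.sum_lt_sum_of_nonempty ?_ fun D hD => hlt C hC v hv D hD
    rw [← Finset.card_pos, Finset.card_erase_of_mem hC]
    omega
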